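/- Let $1/2<p\le 1$, $\rho=p^{-1}(1-p)$, and let $\mu$ be the Bernoulli product measure on $\Omega=\{-1,1\}^{\mathbb Z}$ with $\mu\{\omega_0=1\}=p$. For $\omega\in\Omega$ let $x=(x_n)_{n\in\mathbb Z}$ be the two-sided walk with $x_0=0$ and $x_n-x_{n-1}=\omega_n$, let $s_n=\sup_{m\le n}x_m$ and $y_n=2s_n-x_n$. On $\Omega'=\{s_0<\infty\}$ define $T$ by $(T\omega)_n=y_n-y_{n-1}$. Let $(R\omega)_n=\omega_{-n}$ and $\Omega''=\{\omega\in\Omega':\liminf_{n\to\infty}(s_n-x_n)=0\}$. For $k\ge 0$ let $T^k$ be the $k$-th iterate of $T$, and let $T^{-k}$ be the $k$-th iterate of $RTR$. Let $\Omega^*$ be the set of those $\omega$ for which $T^k\omega$ and $RT^k\omega$ lie in $\Omega''$ for all $k\in\mathbb Z$. Then $\mu(\Omega^*)=1$, $T$ maps $\Omega^*$ bijectively onto itself, and $T^k\omega\in\Omega^*$ and $T(T^k\omega)=T^{k+1}\omega$ for all $\omega\in\Omega^*$ and $k\in\mathbb Z$. Define $\varphi:\Omega^*\to\mathbb N^{\mathbb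 Z}$, $\mathbb N=\{0,1,2,\dots\}$, by $(\varphi\omega)_k=s_0(T^k\omega)$. Let $\theta$ be the shift $(\theta\alpha)_k=\alpha_{k+1}$ on $\mathbb N^{\mathbb Z}$, and $\gamma$ the product measure on $\mathbb N^{\mathbb Z}$ with $\gamma\{\alpha_0=n\}=(1-\rho)\rho^n$ for $n\ge 0$. Then: (i) $\varphi$ is measurable and $\mu\circ\varphi^{-1}=\gamma$. (ii) Almost every $\omega\in\Omega^*$ is uniquely determined by $\varphi\omega$: there is a measurable set $A\subseteq\Omega^*$ with $\mu(A)=1$, mapped bijectively onto itself by $T$, on which $\varphi$ is injective. (iii) $T=\varphi^{-1}\circ\theta\circ\varphi$ almost everywhere: the set $A$ in (ii) can be chosen such that there is a measurable map $\psi:\mathbb N^{\mathbb Z}\to\Omega$ with $\gamma\circ\psi^{-1}=\mu$, $\psi(\varphi\omega)=\omega$ for all $\omega\in A$, $\psi\alpha\in A$ and $\varphi(\psi\alpha)=\alpha$ for $\gamma$-almost every $\alpha$, and $T\omega=\psi(\theta(\varphi\omega))$ for all $\omega\in A$. Consequently $(\Omega,\mu,T)$ is metrically isomorphic to the two-sided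 Bernoulli shift $(\mathbb N^{\mathbb Z},\gamma,\theta)$: both transformations preserve their measures, and there are measure-preserving maps between the two spaces that are inverse to each other almost everywhere and intertwine $T$ and $\theta$ almost everywhere. -/

import Mathlib

open MeasureTheory Set Filter

noncomputable section

namespace BurkeShift

/-! ### The random walk and the transformation `T` -/

/-- The space `Ω = {-1, 1}^ℤ`; the group of units of `ℤ` is exactly `{1, -1}`. -/
abbrev Om : Type := ℤ → ℤˣ

/-- The two-sided walk with `x 0 = 0` and increments `x n - x (n - 1) = ω n`. -/
def x (ω : Om) (n : ℤ) : ℤ :=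
  ∑ i ∈ Finset.Ioc 0 n, (ω i : ℤ) - ∑ i ∈ Finset.Ioc n 0, (ω i : ℤ)

/-- `s n = sup_{m ≤ n} x m`. It is the genuine supremum for `ω ∈ OmFin` (where every set
`{x m : m ≤ n}` is bounded above); for other `ω` it is a default value. -/
def s (ω : Om) (n : ℤ) : ℤ := sSup (x ω '' Iic n)

/-- `y = 2 s - x`. -/
def y (ω : Om) (n : ℤ) : ℤ := 2 * s ω n - x ω n

/-- `Ω'`: the set where `s 0 = sup_{m ≤ 0} x m` is finite. -/
def OmFin : Set Om := {ω | BddAbove (x ω '' Iic 0)}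

/-- `Ω''`: the points of `Ω'` with `liminf_{n → ∞} (s n - x n) = 0`. As `s n - x n` is a
nonnegative integer, this says that `s n - x n = 0` for arbitrarily large `n`. -/
def OmRec : Set Om := {ω | ω ∈ OmFin ∧ ∃ᶠ n in (atTop : Filter ℤ), s ω n - x ω n = 0}

theorem x_zero (ω : Om) : x ω 0 = 0 := by simp [x]

theorem x_sub_one (ω : Om) (n : ℤ) : x ω n - x ω (n - 1) = ω n := by
  unfold x
  rcases le_or_gt n 0 with h | h
  · have h1 : Finset.Ioc (n - 1) 0 = insert n (Finset.Ioc n 0) := by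
      ext i; simp only [Finset.mem_Ioc, Finset.mem_insert]; omega
    rw [h1, Finset.sum_insert (by simp), Finset.Ioc_eq_empty (by omega : ¬ (0 : ℤ) < n),
      Finset.Ioc_eq_empty (by omega : ¬ (0 : ℤ) < n - 1)]
    ring
  · have h1 : Finset.Ioc 0 n = insert n (Finset.Ioc 0 (n - 1)) := by
      ext i; simp only [Finset.mem_Ioc, Finset.mem_insert]; omega
    rw [h1, Finset.sum_insert (by simp), Finset.Ioc_eq_empty (by omega : ¬ n < 0),
      Finset.Ioc_eq_empty (by omega : ¬ n - 1 < 0)]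
    ring

/-- The increments of `y` are again `±1`. -/
theorem isUnit_y_sub (ω : Om) (n : ℤ) : IsUnit (y ω n - y ω (n - 1)) := by
  have hx := x_sub_one ω n
  have hset : x ω '' Iic n = insert (x ω n) (x ω '' Iic (n - 1)) := by
    rw [← image_insert_eq]
    congr 1
    ext i
    simp only [mem_Iic, mem_insert_iff]
    omega
  have hne : (x ω '' Iic (n - 1)).Nonempty := ⟨_, n - 1, by simp, rfl⟩
  by_cases hb : BddAbove (x ω '' Iic (n - 1))
  · have h1 : s ω n = max (x ω n) (s ω (n - 1)) := by
      unfold s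
      rw [hset, csSup_insert hb hne]
    have h2 : x ω (n - 1) ≤ s ω (n - 1) := le_csSup hb ⟨n - 1, by simp, rfl⟩
    rw [Int.isUnit_iff]
    unfold y
    rcases Int.units_eq_one_or (ω n) with h | h <;> rw [h] at hx <;> push_cast at hx <;> omega
  · have hb' : ¬ BddAbove (x ω '' Iic n) := by rwa [hset, bddAbove_insert]
    have h1 : s ω n = s ω (n - 1) := by
      unfold s
      rw [csSup_of_not_bddAbove hb, csSup_of_not_bddAbove hb']
    have h2 : y ω n - y ω (n - 1) = ((-ω n : ℤˣ) : ℤ) := by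
      unfold y
      rw [h1]
      push_cast
      linarith
    rw [h2]
    exact Units.isUnit _

/-- The transformation `(T ω) n = y n - y (n - 1)`. -/
def T (ω : Om) : Om := fun n => (isUnit_y_sub ω n).unit

theorem coe_T (ω : Om) (n : ℤ) : (T ω n : ℤ) = y ω n - y ω (n - 1) := rfl

/-- Time reversal `(R ω) n = ω (-n)`. -/
def R (ω : Om) : Om := fun n => ω (-n)

/-- The inverse transformation `R T R` of `T`. -/
def Tinv (ω : Om) : Om := R (T (R ω))

/-- The integer powers `T^k`, the negative ones being the iterates of the inverse of `T`. -/
def Tpow : ℤ → Om → Om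
  | Int.ofNat n => T^[n]
  | Int.negSucc n => Tinv^[n + 1]

/-- `Ω*`: the set on which all powers `T^k` are defined. The whole two-sided orbit, and its time
reversal, stays inside `Ω''`, where `R T R` does invert `T`. -/
def OmStar : Set Om := {ω | ∀ k : ℤ, Tpow k ω ∈ OmRec ∧ R (Tpow k ω) ∈ OmRec}

/-- `(φ ω) k = s_0(T^k ω)`, for `ω ∈ Ω*` (where `s_0(T^k ω) ≥ x_0 = 0`). -/
def phi (ω : Om) : ℤ → ℕ := fun k => (s (Tpow k ω) 0).toNat

/-- The shift on `ℕ^ℤ`. -/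
def shift (α : ℤ → ℕ) : ℤ → ℕ := fun k => α (k + 1)

/-! ### The measures -/

/-- `μ`: the product measure on `{-1, 1}^ℤ` with `μ {ω 0 = 1} = p`. -/
def mu (p : unitInterval) : Measure Om :=
  Measure.infinitePi fun _ : ℤ => ProbabilityTheory.bernoulliMeasure (1 : ℤˣ) (-1) p

/-- `ρ = p⁻¹ (1 - p)`. -/
def rho (p : unitInterval) : ℝ := (p : ℝ)⁻¹ * (1 - p)

/-- The measure on `ℕ` giving mass `(1 - r) r ^ n` to each `n`. -/
def geom (r : ℝ) : Measure ℕ :=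
  Measure.sum fun n : ℕ => ENNReal.ofReal ((1 - r) * r ^ n) • Measure.dirac n

theorem isProbabilityMeasure_geom {r : ℝ} (h0 : 0 ≤ r) (h1 : r < 1) :
    IsProbabilityMeasure (geom r) := by
  have h := (hasSum_geometric_of_lt_one h0 h1).mul_left (1 - r)
  rw [mul_inv_cancel₀ (by linarith)] at h
  exact h.isProbabilityMeasure_sum_dirac
    fun n => mul_nonneg (by linarith) (pow_nonneg h0 n)

/-- `γ`: the product measure on `ℕ^ℤ` with `γ {α 0 = n} = (1 - ρ) ρ ^ n` for all `n ≥ 0`. -/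
def gam (p : unitInterval) : Measure (ℤ → ℕ) :=
  Measure.infinitePi fun _ : ℤ => geom (rho p)

/-- Two measure-preserving transformations are metrically isomorphic: there are measure-preserving
maps between the spaces, inverse to each other almost everywhere, that intertwine the
transformations almost everywhere. -/
def MetricallyIsomorphic {X Y : Type*} [MeasurableSpace X] [MeasurableSpace Y]
    (S : X → X) (m : Measure X) (S' : Y → Y) (m' : Measure Y) : Prop :=
  MeasurePreserving S m m ∧ MeasurePreserving S' m' m' ∧
    ∃ (f : X → Y) (g : Y → X), MeasurePreserving f m m' ∧ MeasurePreserving g m' m ∧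
      (∀ᵐ a ∂m, g (f a) = a) ∧ (∀ᵐ b ∂m', f (g b) = b) ∧ (∀ᵐ a ∂m, f (S a) = S' (f a))

end BurkeShift

end

open BurkeShift

noncomputable section

namespace BurkeShift

/-! ### One step of the queue -/

/-! Read `q = s - x` as a queue in discrete time: `ω n = -1` is an arrival, `ω n = 1` an offered
service, and `T ω n = -1` marks an actual departure. One time step maps (queue length, input) to
(new queue length, output) by `tau`. Two facts about `tau` drive everything: it is an involution
(`tau_tau`), and it preserves geometric(ρ) × Bernoulli(p), because ρp = 1 - p (`geom_mul_ber_tau`).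

Measure. The stationary queue length is geometric (`mu_q_eq`). Since `tau` preserves the product
law, induction over time steps gives Burke's theorem (`burke_past`): the outputs up to time 0 are
i.i.d. with law Bernoulli(p) and independent of the queue length at time 0. Hence `T` preserves μ.
Moreover `φ_1, φ_2, …` are functions of the past of `T ω`, hence independent of `φ_0`; iterating
(`phi_cylinder`) and using stationarity, φ pushes μ to γ.

Inverse. By Pitman's identity `s n = inf_{j ≥ n} y j` for recurrent paths, the walk is recovered
from `y`, and the recovery is `R T R` (`s_R_T`, `Tinv_T`).

Injectivity. Consider the lattice of queue lengths `q (T^k ω) n`, linked by `tau`. The column n = 0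
is `φ ω`. An empty queue emits 1 whatever its input, so zeros of the column far back in `k` start a
recursion that determines the next column; since `tau` is an involution, zeros far ahead give the
previous one. Almost surely every column has such zeros (`ae_mem_OmEmpty`). Injectivity on a Borel
set then yields a measurable inverse. -/

/-- The reflected walk `s n - x n`, read as the length of a queue at time `n`. -/
def q (ω : Om) (n : ℤ) : ℕ := (s ω n - x ω n).toNat

/-- One step of the queue: from the queue length and the input to the new queue length and the
output. -/
def tau (a : ℕ × ℤˣ) : ℕ × ℤˣ :=
  if a.2 = 1 then (a.1 - 1, if a.1 = 0 then 1 else -1) else (a.1 + 1, 1)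

/-- An arrival `(n, -1)` and a departure `(n + 1, 1)` are exchanged, and an idle service `(0, 1)` is
fixed. This is the reversibility of the queue: the same rule runs it backwards. -/
theorem tau_tau (a : ℕ × ℤˣ) : tau (tau a) = a := by
  obtain ⟨n, e⟩ := a
  rcases Int.units_eq_one_or e with rfl | rfl
  · rcases n with _ | n <;> simp [tau]
  · simp [tau]

theorem tau_eq_iff {a b : ℕ × ℤˣ} : tau a = b ↔ a = tau b :=
  ⟨fun h => by rw [← h, tau_tau], fun h => by rw [h, tau_tau]⟩

/-- Nothing departs from an empty queue. The output is thus known without the input, which starts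
the recursions for injectivity. -/
theorem tau_zero (e : ℤˣ) : (tau (0, e)).2 = 1 := by
  rcases Int.units_eq_one_or e with rfl | rfl <;> simp [tau]

theorem funext_of_sub_eq {f g : ℤ → ℤ} (h0 : f 0 = g 0)
    (h : ∀ n, f n - f (n - 1) = g n - g (n - 1)) (n : ℤ) : f n = g n := by
  induction n using Int.induction_on with
  | zero => exact h0
  | succ k ih =>
    have := h (k + 1)
    rw [add_sub_cancel_right] at this
    linarith
  | pred k ih =>
    have := h (-k)
    linarith

theorem bddAbove_Iic_iff (ω : Om) (n : ℤ) : BddAbove (x ω '' Iic n) ↔ ω ∈ OmFin := by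
  have key : ∀ a b : ℤ, BddAbove (x ω '' Iic a) → BddAbove (x ω '' Iic b) := by
    intro a b h
    have h2 : BddAbove (x ω '' Ioc a b) := ((finite_Ioc a b).image _).bddAbove
    refine (h.union h2).mono ?_
    rw [← image_union]
    apply image_mono
    intro i hi
    simp only [mem_union, mem_Iic, mem_Ioc] at hi ⊢
    omega
  exact ⟨key n 0, key 0 n⟩

theorem x_le_s {ω : Om} (h : ω ∈ OmFin) {m n : ℤ} (hmn : m ≤ n) : x ω m ≤ s ω n :=
  le_csSup ((bddAbove_Iic_iff ω n).2 h) ⟨m, hmn, rfl⟩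

theorem s_step {ω : Om} (h : ω ∈ OmFin) (n : ℤ) : s ω n = max (x ω n) (s ω (n - 1)) := by
  have hset : x ω '' Iic n = insert (x ω n) (x ω '' Iic (n - 1)) := by
    rw [← image_insert_eq]
    congr 1
    ext i
    simp only [mem_Iic, mem_insert_iff]
    omega
  unfold s
  rw [hset, csSup_insert ((bddAbove_Iic_iff ω (n - 1)).2 h) ⟨_, n - 1, by simp, rfl⟩]

theorem coe_q {ω : Om} (h : ω ∈ OmFin) (n : ℤ) : (q ω n : ℤ) = s ω n - x ω n :=
  Int.toNat_of_nonneg (sub_nonneg.2 (x_le_s h le_rfl))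

theorem step {ω : Om} (h : ω ∈ OmFin) (n : ℤ) :
    (q ω n, T ω n) = tau (q ω (n - 1), ω n) := by
  have h1 := coe_q h n
  have h2 := coe_q h (n - 1)
  have h3 := s_step h n
  have h4 := x_sub_one ω n
  have h5 := coe_T ω n
  unfold y at h5
  rcases Int.units_eq_one_or (ω n) with e | e <;> rw [e] at h4 ⊢ <;> push_cast at h4
  · rcases Nat.eq_zero_or_pos (q ω (n - 1)) with h0 | h0
    · have hT : T ω n = 1 := Units.ext (by push_cast; omega)
      rw [hT]
      simp only [tau, if_true, h0, Prod.mk.injEq, and_true]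
      omega
    · have hT : T ω n = -1 := Units.ext (by push_cast; omega)
      rw [hT]
      simp only [tau, if_true, Prod.mk.injEq]
      constructor
      · omega
      · rw [if_neg (by omega)]
  · have hT : T ω n = 1 := Units.ext (by push_cast; omega)
    rw [hT]
    simp only [tau]
    rw [if_neg (by decide)]
    simp only [Prod.mk.injEq, and_true]
    omega

/-! ### Time shifts -/

/-- The shift of time by `n`. -/
def sh (n : ℤ) (ω : Om) : Om := fun i => ω (i + n)

theorem x_sh (n : ℤ) (ω : Om) (m : ℤ) : x (sh n ω) m = x ω (m + n) - x ω n := by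
  revert m
  apply funext_of_sub_eq
  · simp [x_zero]
  · intro m
    rw [x_sub_one, show m - 1 + n = m + n - 1 by ring]
    have := x_sub_one ω (m + n)
    simp only [sh]
    linarith

theorem x_sh_image (n : ℤ) (ω : Om) (m : ℤ) :
    x (sh n ω) '' Iic m = (fun z => z - x ω n) '' (x ω '' Iic (m + n)) := by
  ext z
  simp only [mem_image, mem_Iic, x_sh, exists_exists_and_eq_and]
  constructor
  · rintro ⟨i, hi, rfl⟩
    exact ⟨i + n, by omega, rfl⟩
  · rintro ⟨i, hi, rfl⟩
    exact ⟨i - n, by omega, by simp⟩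

theorem sh_mem_OmFin {n : ℤ} {ω : Om} : sh n ω ∈ OmFin ↔ ω ∈ OmFin := by
  rw [← bddAbove_Iic_iff ω (0 + n)]
  simp only [OmFin, mem_ofPred_eq, x_sh_image]
  constructor
  · rintro ⟨C, hC⟩
    exact ⟨C + x ω n, fun z hz => by
      have := hC (mem_image_of_mem _ hz)
      linarith⟩
  · rintro ⟨C, hC⟩
    refine ⟨C - x ω n, ?_⟩
    rintro _ ⟨z, hz, rfl⟩
    have := hC hz
    simp only
    linarith

theorem s_sh {ω : Om} (h : ω ∈ OmFin) (n m : ℤ) : s (sh n ω) m = s ω (m + n) - x ω n := by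
  refine IsLUB.csSup_eq ?_ ⟨_, m, le_refl m, rfl⟩
  rw [x_sh_image]
  have h1 := isLUB_csSup (⟨_, m + n, le_refl (m + n), rfl⟩ : (x ω '' Iic (m + n)).Nonempty)
    ((bddAbove_Iic_iff ω (m + n)).2 h)
  exact (OrderIso.subRight (x ω n)).isLUB_image'.2 h1

theorem s_of_notMem {ω : Om} (h : ω ∉ OmFin) (n : ℤ) : s ω n = 0 := by
  unfold s
  rw [csSup_of_not_bddAbove (mt (bddAbove_Iic_iff ω n).1 h), Int.csSup_empty]

theorem q_sh {ω : Om} (h : ω ∈ OmFin) (n m : ℤ) : q (sh n ω) m = q ω (m + n) := by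
  simp [q, s_sh h, x_sh]

theorem T_sh (n : ℤ) (ω : Om) : T (sh n ω) = sh n (T ω) := by
  funext i
  apply Units.ext
  rw [coe_T]
  simp only [sh, coe_T, y]
  by_cases h : ω ∈ OmFin
  · rw [s_sh h, s_sh h, x_sh, x_sh, show i - 1 + n = i + n - 1 by ring]
    ring
  -- Outside `OmFin` the default supremum 0 is the same before and after shifting, so the
  -- commutation holds for every `ω`.
  · rw [s_of_notMem h, s_of_notMem h, s_of_notMem (mt sh_mem_OmFin.1 h),
      s_of_notMem (mt sh_mem_OmFin.1 h), x_sh, x_sh, show i - 1 + n = i + n - 1 by ring]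
    ring

theorem R_R (ω : Om) : R (R ω) = ω := by
  funext i
  simp [R]

theorem R_sh (n : ℤ) (ω : Om) : R (sh n ω) = sh (-n) (R ω) := by
  funext i
  simp only [R, sh]
  congr 1
  ring

theorem Tinv_sh (n : ℤ) (ω : Om) : Tinv (sh n ω) = sh n (Tinv ω) := by
  simp [Tinv, R_sh, T_sh]

theorem Tpow_sh (k n : ℤ) (ω : Om) : Tpow k (sh n ω) = sh n (Tpow k ω) := by
  rcases k with k | k
  · exact (show Function.Commute T (sh n) from T_sh n).iterate_left k ω
  · exact (show Function.Commute Tinv (sh n) from Tinv_sh n).iterate_left (k + 1) ω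

/-! ### Dependence on the past only -/

theorem x_congr {ω ω' : Om} (h : ∀ i ≤ 0, ω i = ω' i) {n : ℤ} (hn : n ≤ 0) :
    x ω n = x ω' n := by
  unfold x
  rw [Finset.Ioc_eq_empty (by omega : ¬ (0 : ℤ) < n)]
  congr 1
  refine Finset.sum_congr rfl fun i hi => ?_
  rw [h i (Finset.mem_Ioc.1 hi).2]

theorem s_congr {ω ω' : Om} (h : ∀ i ≤ 0, ω i = ω' i) {n : ℤ} (hn : n ≤ 0) :
    s ω n = s ω' n := by
  unfold s
  exact congrArg sSup (image_congr fun i (hi : i ≤ n) => x_congr h (hi.trans hn))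

theorem T_congr {ω ω' : Om} (h : ∀ i ≤ 0, ω i = ω' i) : ∀ i ≤ 0, T ω i = T ω' i := by
  intro i hi
  apply Units.ext
  simp only [coe_T, y]
  rw [s_congr h hi, s_congr h (by omega : i - 1 ≤ 0), x_congr h hi,
    x_congr h (by omega : i - 1 ≤ 0)]

theorem T_iterate_congr {ω ω' : Om} (h : ∀ i ≤ 0, ω i = ω' i) (k : ℕ) :
    ∀ i ≤ 0, T^[k] ω i = T^[k] ω' i := by
  induction k with
  | zero => exact h
  | succ k ih =>
    rw [Function.iterate_succ_apply', Function.iterate_succ_apply']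
    exact T_congr ih

theorem q_congr {ω ω' : Om} (h : ∀ i ≤ 0, ω i = ω' i) : q ω 0 = q ω' 0 := by
  unfold q
  rw [s_congr h le_rfl, x_congr h le_rfl]

theorem phi_eq_q (ω : Om) (k : ℤ) : phi ω k = q (Tpow k ω) 0 := by
  simp [phi, q, x_zero]

/-! ### The inverse of `T` -/

theorem x_R (ω : Om) (n : ℤ) : x (R ω) n = x ω (-1) - x ω (-1 - n) := by
  revert n
  apply funext_of_sub_eq
  · simp [x_zero]
  · intro n
    rw [x_sub_one]
    have := x_sub_one ω (-n)
    simp only [R]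
    rw [← this, show -1 - (n - 1) = -n by ring, show -1 - n = -n - 1 by ring]
    ring

theorem x_T (ω : Om) (n : ℤ) : x (T ω) n = y ω n - y ω 0 := by
  revert n
  apply funext_of_sub_eq
  · simp [x_zero]
  · intro n
    rw [x_sub_one, coe_T]
    ring

theorem s_mono {ω : Om} (h : ω ∈ OmFin) : Monotone (s ω) := fun m n hmn =>
  csSup_le_csSup ((bddAbove_Iic_iff ω n).2 h) ⟨_, m, le_refl m, rfl⟩
    (image_mono (Iic_subset_Iic.2 hmn))

/-- The walk has unit steps, so just before the supremum first exceeds `s ω n` the walk sits exactly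
at that level. -/
theorem exists_s_eq_of_ne {ω : Om} (h : ω ∈ OmFin) {n m : ℤ} (hnm : n ≤ m)
    (hm : s ω m ≠ s ω n) : ∃ j, n ≤ j ∧ s ω j = s ω n ∧ x ω j = s ω n := by
  induction m, hnm using Int.leInduction with
  | base => exact absurd rfl hm
  | succ m hnm ih =>
    have h1 := s_step h (m + 1)
    have h2 := x_sub_one ω (m + 1)
    have h3 := x_le_s h (le_refl m)
    rw [add_sub_cancel_right] at h1 h2
    by_cases hs : s ω m = s ω n
    · refine ⟨m, hnm, hs, ?_⟩
      rcases Int.units_eq_one_or (ω (m + 1)) with e | e <;> rw [e] at h2 <;>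
        push_cast at h2 <;> omega
    · exact ih hs

theorem exists_s_eq {ω : Om} (h : ω ∈ OmFin) {n m : ℤ} (hnm : n ≤ m)
    (hm : s ω m - x ω m = 0) : ∃ j, n ≤ j ∧ s ω j = s ω n ∧ x ω j = s ω n := by
  by_cases hs : s ω m = s ω n
  · exact ⟨m, hnm, hs, by omega⟩
  · exact exists_s_eq_of_ne h hnm hs

/-- Pitman's identity after time reversal: for `j ≥ m` one has `y j ≥ s j ≥ s m`, and recurrence
provides a `j` with `x j = s j = s m`, where equality holds. -/
theorem s_R_T {ω : Om} (h : ω ∈ OmRec) (n : ℤ) :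
    s (R (T ω)) n = y ω (-1) - s ω (-1 - n) := by
  refine IsGreatest.csSup_eq ⟨?_, ?_⟩
  · obtain ⟨m, hm, hm'⟩ := frequently_atTop.1 h.2 (-1 - n)
    obtain ⟨j, hj, hj1, hj2⟩ := exists_s_eq h.1 hm hm'
    refine ⟨-1 - j, by simp only [mem_Iic]; omega, ?_⟩
    rw [x_R, x_T, x_T, show -1 - (-1 - j) = j by ring]
    simp only [y]
    rw [hj1, hj2]
    ring
  · rintro _ ⟨j, hj, rfl⟩
    rw [mem_Iic] at hj
    rw [x_R, x_T, x_T]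
    have h1 := s_mono h.1 (by omega : -1 - n ≤ -1 - j)
    have h2 := x_le_s h.1 (le_refl (-1 - j))
    simp only [y]
    linarith

theorem Tinv_T {ω : Om} (h : ω ∈ OmRec) : Tinv (T ω) = ω := by
  funext i
  apply Units.ext
  simp only [Tinv, R, coe_T]
  simp only [y]
  rw [s_R_T h, s_R_T h, x_R, x_R, x_T, x_T, x_T, show -1 - (-i) = i - 1 by ring,
    show -1 - (-i - 1) = i by ring, ← x_sub_one ω i]
  simp only [y]
  ring

theorem T_Tinv {ω : Om} (h : R ω ∈ OmRec) : T (Tinv ω) = ω := by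
  have := congrArg R (Tinv_T h)
  simpa [Tinv, R_R] using this

/-! ### `Ω*` and the powers of `T` -/

theorem Tpow_zero (ω : Om) : Tpow 0 ω = ω := rfl

theorem T_Tpow {ω : Om} (h : ω ∈ OmStar) (k : ℤ) : T (Tpow k ω) = Tpow (k + 1) ω := by
  rcases k with k | k
  · exact (Function.iterate_succ_apply' T k ω).symm
  · rcases k with _ | k
    · exact T_Tinv (h 0).2
    · have h1 : Tpow (Int.negSucc (k + 1)) ω = Tinv (Tpow (Int.negSucc k) ω) :=
        Function.iterate_succ_apply' Tinv (k + 1) ω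
      rw [h1, T_Tinv (h (Int.negSucc k)).2]
      rfl

theorem Tinv_Tpow {ω : Om} (h : ω ∈ OmStar) (k : ℤ) : Tinv (Tpow k ω) = Tpow (k - 1) ω := by
  have h1 := T_Tpow h (k - 1)
  rw [sub_add_cancel] at h1
  rw [← h1, Tinv_T (h (k - 1)).1]

theorem Tpow_T {ω : Om} (h : ω ∈ OmStar) (k : ℤ) : Tpow k (T ω) = Tpow (k + 1) ω := by
  rcases k with k | k
  · rfl
  · change Tinv^[k] (Tinv (T ω)) = _
    rw [Tinv_T (Tpow_zero ω ▸ (h 0).1)]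
    rcases k with _ | k <;> rfl

theorem Tpow_Tinv {ω : Om} (h : ω ∈ OmStar) (k : ℤ) : Tpow k (Tinv ω) = Tpow (k - 1) ω := by
  rcases k with k | k
  · rcases k with _ | k
    · rfl
    · change T^[k] (T (Tinv ω)) = _
      rw [T_Tinv (Tpow_zero ω ▸ (h 0).2), show Int.ofNat (k + 1) - 1 = Int.ofNat k by simp]
      rfl
  · rfl

theorem T_mem_OmStar {ω : Om} (h : ω ∈ OmStar) : T ω ∈ OmStar := fun k => by
  rw [Tpow_T h]
  exact h (k + 1)

theorem Tinv_mem_OmStar {ω : Om} (h : ω ∈ OmStar) : Tinv ω ∈ OmStar := fun k => by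
  rw [Tpow_Tinv h]
  exact h (k - 1)

theorem Tpow_mem_OmStar {ω : Om} (h : ω ∈ OmStar) (k : ℤ) : Tpow k ω ∈ OmStar := by
  induction k using Int.induction_on with
  | zero => exact h
  | succ k ih =>
    rw [← T_Tpow h]
    exact T_mem_OmStar ih
  | pred k ih =>
    rw [← Tinv_Tpow h]
    exact Tinv_mem_OmStar ih

theorem bijOn_T {A : Set Om} (hA : A ⊆ OmStar) (h1 : MapsTo T A A) (h2 : MapsTo Tinv A A) :
    BijOn T A A :=
  InvOn.bijOn ⟨fun _ h => Tinv_T (hA h 0).1, fun _ h => T_Tinv (hA h 0).2⟩ h1 h2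

theorem phi_T {ω : Om} (h : ω ∈ OmStar) : phi (T ω) = shift (phi ω) := by
  funext k
  simp only [phi, shift, Tpow_T h]

/-! ### Recovering the path from the queue lengths at time `0` -/

/-- The points of `Ω*` for which at each time there are empty queues arbitrarily far in both
directions. -/
def OmEmpty : Set Om := {ω | ω ∈ OmStar ∧ ∀ n K : ℤ,
  (∃ k, K ≤ k ∧ q (Tpow k ω) n = 0) ∧ ∃ k, k ≤ K ∧ q (Tpow k ω) n = 0}

theorem mapsTo_T_OmEmpty : MapsTo T OmEmpty OmEmpty := by
  refine fun ω h => ⟨T_mem_OmStar h.1, fun n K => ?_⟩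
  obtain ⟨⟨k, hk, hk'⟩, l, hl, hl'⟩ := h.2 n (K + 1)
  simp only [Tpow_T h.1]
  exact ⟨⟨k - 1, by omega, by simpa⟩, l - 1, by omega, by simpa⟩

theorem mapsTo_Tinv_OmEmpty : MapsTo Tinv OmEmpty OmEmpty := by
  refine fun ω h => ⟨Tinv_mem_OmStar h.1, fun n K => ?_⟩
  obtain ⟨⟨k, hk, hk'⟩, l, hl, hl'⟩ := h.2 n (K - 1)
  simp only [Tpow_Tinv h.1]
  exact ⟨⟨k + 1, by omega, by simpa⟩, l + 1, by omega, by simpa⟩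

theorem step_Tpow {ω : Om} (h : ω ∈ OmStar) (k n : ℤ) :
    (q (Tpow k ω) n, Tpow (k + 1) ω n) = tau (q (Tpow k ω) (n - 1), Tpow k ω n) := by
  rw [← T_Tpow h]
  exact step (h k).1.1 n

theorem step_Tpow' {ω : Om} (h : ω ∈ OmStar) (k n : ℤ) :
    (q (Tpow k ω) (n - 1), Tpow k ω n) = tau (q (Tpow k ω) n, Tpow (k + 1) ω n) :=
  (tau_eq_iff.1 (step_Tpow h k n).symm)

/-- A zero of column `n - 1` below `k` fixes the symbol on the next row at time `n`; from there
`tau` determines the symbols row by row upwards. -/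
theorem eq_of_q_sub_one_eq {ω ω' : Om} (h : ω ∈ OmEmpty) (h' : ω' ∈ OmEmpty) {n : ℤ}
    (hq : ∀ k, q (Tpow k ω) (n - 1) = q (Tpow k ω') (n - 1)) (k : ℤ) :
    Tpow k ω n = Tpow k ω' n := by
  obtain ⟨l, hl, hl0⟩ := (h.2 (n - 1) (k - 1)).2
  have hl0' := (hq l).symm.trans hl0
  have hbase : Tpow (l + 1) ω n = Tpow (l + 1) ω' n := by
    have h1 := congrArg Prod.snd (step_Tpow h.1 l n)
    have h2 := congrArg Prod.snd (step_Tpow h'.1 l n)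
    rw [hl0, tau_zero] at h1
    rw [hl0', tau_zero] at h2
    exact h1.trans h2.symm
  have hlk : l + 1 ≤ k := by omega
  induction k, hlk using Int.leInduction with
  | base => exact hbase
  | succ k hk ih =>
    have h1 := congrArg Prod.snd (step_Tpow h.1 k n)
    have h2 := congrArg Prod.snd (step_Tpow h'.1 k n)
    rw [hq k, ih (by omega)] at h1
    exact h1.trans h2.symm

/-- The mirror image: with `tau` run backwards, a zero of column `n` above `k` fixes the symbol
there, and the recursion descends. -/
theorem eq_of_q_eq {ω ω' : Om} (h : ω ∈ OmEmpty) (h' : ω' ∈ OmEmpty) {n : ℤ}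
    (hq : ∀ k, q (Tpow k ω) n = q (Tpow k ω') n) (k : ℤ) :
    Tpow k ω n = Tpow k ω' n := by
  obtain ⟨l, hl, hl0⟩ := (h.2 n k).1
  have hl0' := (hq l).symm.trans hl0
  have hbase : Tpow l ω n = Tpow l ω' n := by
    have h1 := congrArg Prod.snd (step_Tpow' h.1 l n)
    have h2 := congrArg Prod.snd (step_Tpow' h'.1 l n)
    rw [hl0, tau_zero] at h1
    rw [hl0', tau_zero] at h2
    exact h1.trans h2.symm
  induction k, hl using Int.leInductionDown with
  | base => exact hbase
  | pred k hk ih =>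
    have h1 := congrArg Prod.snd (step_Tpow' h.1 (k - 1) n)
    have h2 := congrArg Prod.snd (step_Tpow' h'.1 (k - 1) n)
    rw [sub_add_cancel] at h1 h2
    rw [hq (k - 1), ih] at h1
    exact h1.trans h2.symm

theorem q_eq_of_phi_eq {ω ω' : Om} (h : ω ∈ OmEmpty) (h' : ω' ∈ OmEmpty)
    (hφ : phi ω = phi ω') (n : ℤ) : ∀ k, q (Tpow k ω) n = q (Tpow k ω') n := by
  induction n using Int.induction_on with
  | zero =>
    intro k
    rw [← phi_eq_q, ← phi_eq_q, hφ]
  | succ n ih =>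
    intro k
    have ih' : ∀ k, q (Tpow k ω) ((n : ℤ) + 1 - 1) = q (Tpow k ω') ((n : ℤ) + 1 - 1) := by
      simpa using ih
    have h1 := congrArg Prod.fst (step_Tpow h.1 k (n + 1))
    have h2 := congrArg Prod.fst (step_Tpow h'.1 k (n + 1))
    rw [ih' k, eq_of_q_sub_one_eq h h' ih' k] at h1
    exact h1.trans h2.symm
  | pred n ih =>
    intro k
    have h1 := congrArg Prod.fst (step_Tpow' h.1 k (-n))
    have h2 := congrArg Prod.fst (step_Tpow' h'.1 k (-n))
    rw [ih k, eq_of_q_eq h h' ih (k + 1)] at h1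
    exact h1.trans h2.symm

theorem injOn_phi : InjOn phi OmEmpty := fun _ h _ h' hφ =>
  funext fun n => eq_of_q_eq h h' (q_eq_of_phi_eq h h' hφ n) 0


/-! ### Measurability -/

instance : MeasurableSingletonClass ℤˣ where
  measurableSet_singleton u :=
    ⟨{(u : ℤ)}, MeasurableSet.of_discrete, by ext v; simp [Units.ext_iff]⟩

instance : StandardBorelSpace ℤˣ := inferInstance

theorem measurable_x (n : ℤ) : Measurable fun ω => x ω n := by
  have h : ∀ i : ℤ, Measurable fun ω : Om => (ω i : ℤ) := fun i =>
    (Measurable.of_discrete (f := fun u : ℤˣ => (u : ℤ))).comp (measurable_pi_apply i)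
  exact (Finset.measurable_fun_sum _ fun i _ => h i).sub
    (Finset.measurable_fun_sum _ fun i _ => h i)

theorem measurable_s (n : ℤ) : Measurable fun ω => s ω n := by
  simp only [s, sSup_image']
  exact Measurable.iSup fun i => measurable_x i

theorem measurable_q (n : ℤ) : Measurable fun ω => q ω n :=
  (Measurable.of_discrete (f := Int.toNat)).comp ((measurable_s n).sub (measurable_x n))

theorem measurable_y (n : ℤ) : Measurable fun ω => y ω n :=
  ((measurable_s n).const_mul 2).sub (measurable_x n)

theorem measurable_T : Measurable T := by
  refine measurable_pi_iff.2 fun n => measurable_comap_iff.2 ?_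
  exact (measurable_y n).sub (measurable_y (n - 1))

theorem measurable_R : Measurable R := measurable_pi_iff.2 fun n => measurable_pi_apply (-n)

theorem measurable_sh (n : ℤ) : Measurable (sh n) :=
  measurable_pi_iff.2 fun i => measurable_pi_apply (i + n)

theorem measurable_Tinv : Measurable Tinv := measurable_R.comp (measurable_T.comp measurable_R)

theorem measurable_Tpow (k : ℤ) : Measurable (Tpow k) := by
  rcases k with k | k
  · exact measurable_T.iterate k
  · exact measurable_Tinv.iterate (k + 1)

theorem measurable_phi : Measurable phi := by
  refine measurable_pi_iff.2 fun k => ?_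
  simp only [phi_eq_q]
  exact (measurable_q 0).comp (measurable_Tpow k)

theorem measurableSet_OmFin : MeasurableSet OmFin := by
  have : OmFin = ⋃ C : ℤ, ⋂ m : ℤ, {ω | m ≤ 0 → x ω m ≤ C} := by
    ext ω
    simp [OmFin, bddAbove_def]
  rw [this]
  refine .iUnion fun C => .iInter fun m => ?_
  by_cases hm : m ≤ 0
  · simpa [hm] using measurableSet_le (measurable_x m) measurable_const
  · simp [hm]

theorem measurableSet_OmRec : MeasurableSet OmRec := by
  have : OmRec = OmFin ∩ ⋂ a : ℤ, ⋃ b : ℤ, {ω | a ≤ b ∧ s ω b - x ω b = 0} := by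
    ext ω
    simp [OmRec, frequently_atTop]
  rw [this]
  refine measurableSet_OmFin.inter (.iInter fun a => .iUnion fun b => ?_)
  exact (MeasurableSet.const _).inter
    (((measurable_s b).sub (measurable_x b)) (measurableSet_singleton 0))

theorem measurableSet_OmStar : MeasurableSet OmStar := by
  simp only [OmStar, ofPred_forall, ofPred_and]
  exact .iInter fun k => (measurable_Tpow k measurableSet_OmRec).inter
    ((measurable_R.comp (measurable_Tpow k)) measurableSet_OmRec)

theorem measurableSet_OmEmpty : MeasurableSet OmEmpty := by
  have h : ∀ n k : ℤ, MeasurableSet {ω | q (Tpow k ω) n = 0} := fun n k =>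
    ((measurable_q n).comp (measurable_Tpow k)) (measurableSet_singleton 0)
  simp only [OmEmpty, ofPred_forall, ofPred_and, ofPred_exists]
  exact measurableSet_OmStar.inter (.iInter fun n => .iInter fun K =>
    (MeasurableSet.iUnion fun k => (MeasurableSet.const _).inter (h n k)).inter
    (MeasurableSet.iUnion fun k => (MeasurableSet.const _).inter (h n k)))

/-! ### The measure `μ` -/

variable (p : unitInterval)

instance : IsProbabilityMeasure (mu p) := by
  unfold mu
  infer_instance

/-- The law of one coordinate under `μ`. -/
abbrev ber : Measure ℤˣ := ProbabilityTheory.bernoulliMeasure (1 : ℤˣ) (-1) p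

theorem ber_one : ber p {1} = ENNReal.ofReal p := by
  rw [ber, ProbabilityTheory.bernoulliMeasure_apply_of_mem_of_notMem p (by measurability)
    (by simp) (by decide)]
  rw [← ENNReal.ofReal_coe_nnreal]
  rfl

theorem ber_neg_one : ber p {-1} = ENNReal.ofReal (1 - p) := by
  rw [ber, ProbabilityTheory.bernoulliMeasure_apply_of_notMem_of_mem p (by measurability)
    (by decide) (by simp)]
  rw [← ENNReal.ofReal_coe_nnreal]
  rfl

theorem measurePreserving_sh (n : ℤ) : MeasurePreserving (sh n) (mu p) (mu p) :=
  ⟨measurable_sh n, Measure.map_infinitePi_infinitePi_of_inj (P := fun _ : ℤ => ber p)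
    (add_left_injective n)⟩

theorem measurePreserving_R : MeasurePreserving R (mu p) (mu p) :=
  ⟨measurable_R, Measure.map_infinitePi_infinitePi_of_inj (P := fun _ : ℤ => ber p)
    neg_injective⟩

/-- The coordinate at time `1` is independent of those up to time `0`. -/
theorem mu_inter_eval_one {F : Set Om} (hF : MeasurableSet F)
    (hF' : ∀ ω ω' : Om, (∀ i ≤ 0, ω i = ω' i) → ω ∈ F → ω' ∈ F) (d : ℤˣ) :
    mu p (F ∩ {ω | ω 1 = d}) = mu p F * ber p {d} := by
  have hind := (ProbabilityTheory.iIndepFun_infinitePi (P := fun _ : ℤ => ber p)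
    (X := fun _ u => u) (fun _ => measurable_id))
  rw [ProbabilityTheory.iIndepFun_iff_iIndep] at hind
  have h := ProbabilityTheory.indep_iSup_of_disjoint
    (fun i => (measurable_pi_apply i).comap_le) hind
    (S := Iic (0 : ℤ)) (T := {1}) (by simp)
  have hF0 : MeasurableSet[⨆ i ∈ Iic (0 : ℤ), MeasurableSpace.comap (fun ω : Om => ω i)
      inferInstance] F := by
    -- Resetting all later coordinates to 1 does not affect membership in `F`, and the resetting map
    -- is measurable for the σ-algebra of the past.
    have hg : F = (fun (ω : Om) (i : ℤ) => if i ≤ 0 then ω i else 1) ⁻¹' F := by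
      ext ω
      exact ⟨hF' _ _ fun i hi => by simp [hi], hF' _ _ fun i hi => by simp [hi]⟩
    rw [hg]
    refine (@measurable_pi_lambda Om ℤ (fun _ => ℤˣ) (_) _ _ fun i => ?_) hF
    by_cases hi : i ≤ 0
    · simp only [hi, if_true]
      exact (comap_measurable (fun ω : Om => ω i)).mono
        (le_iSup₂_of_le (f := fun (i : ℤ) (_ : i ∈ Iic 0) =>
          MeasurableSpace.comap (fun ω : Om => ω i) inferInstance) i hi le_rfl) le_rfl
    · simp only [hi, if_false]
      exact measurable_const
  have hd : (mu p) {ω | ω 1 = d} = ber p {d} :=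
    (measurePreserving_eval_infinitePi (fun _ : ℤ => ber p) 1).measure_preimage
      (measurableSet_singleton d).nullMeasurableSet
  rw [← hd]
  refine (ProbabilityTheory.Indep_iff _ _ _).1 h F {ω | ω 1 = d} hF0 ?_
  rw [iSup_singleton]
  exact ⟨{d}, measurableSet_singleton d, rfl⟩

/-! ### Almost every path has a drift -/

/-- The reversed walk tending to ∞ bounds the past from above. If the queue were eventually never
empty, the running supremum would be frozen, contradicting `x → ∞`. -/
theorem mem_OmRec_of_tendsto {ω : Om} (hf : Tendsto (x ω) atTop atTop)
    (hb : Tendsto (x (R ω)) atTop atTop) : ω ∈ OmRec := by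
  have hfin : ω ∈ OmFin := by
    obtain ⟨N, hN⟩ := eventually_atTop.1 (hb.eventually_ge_atTop 0)
    rw [← bddAbove_Iic_iff ω (-1 - N)]
    refine ⟨x ω (-1), ?_⟩
    rintro _ ⟨m, hm, rfl⟩
    rw [mem_Iic] at hm
    have := hN (-1 - m) (by omega)
    rw [x_R, show -1 - (-1 - m) = m by ring] at this
    linarith
  refine ⟨hfin, fun hev => ?_⟩
  obtain ⟨N, hN⟩ := eventually_atTop.1 hev
  have hs : ∀ n, N ≤ n → s ω n = s ω N := by
    intro n hn
    induction n, hn using Int.leInduction with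
    | base => rfl
    | succ n hn ih =>
      have h1 := s_step hfin (n + 1)
      have h2 := hN (n + 1) (by omega)
      rw [add_sub_cancel_right] at h1
      omega
  obtain ⟨n, hn, hn'⟩ := ((hf.eventually_gt_atTop (s ω N)).and (eventually_ge_atTop N)).exists
  have := x_le_s hfin (le_refl n)
  rw [hs n hn'] at this
  omega

variable {p}

/-- Strong law of large numbers: the drift `2p - 1` is positive. -/
theorem ae_tendsto_x (hp : 1 / 2 < (p : ℝ)) : ∀ᵐ ω ∂(mu p), Tendsto (x ω) atTop atTop := by
  set f : ℤˣ → ℝ := fun u => ((u : ℤ) : ℝ) with hf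
  have hfm : Measurable f := Measurable.of_discrete
  have hev : ∀ i : ℤ, MeasurePreserving (fun ω : Om => ω i) (mu p) (ber p) := fun i =>
    measurePreserving_eval_infinitePi (fun _ : ℤ => ber p) i
  have hint : Integrable f (ber p) := ProbabilityTheory.integrable_bernoulliMeasure _ _ _ _
  have hE : ∫ ω, f (ω ((0 : ℕ) + 1 : ℤ)) ∂(mu p) = 2 * p - 1 := by
    rw [← integral_map (φ := fun ω : Om => ω ((0 : ℕ) + 1 : ℤ)) (f := f)
      (hev _).measurable.aemeasurable hfm.aestronglyMeasurable, (hev _).map_eq,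
      ProbabilityTheory.integral_bernoulliMeasure]
    simp [hf]
    ring
  have h := ProbabilityTheory.strong_law_ae_real (μ := mu p)
    (fun (i : ℕ) (ω : Om) => f (ω (i + 1)))
    ((hev ((0 : ℕ) + 1)).integrable_comp_of_integrable hint)
    (fun i j hij => (ProbabilityTheory.iIndepFun_infinitePi (P := fun _ : ℤ => ber p)
      (X := fun _ => f) (fun _ => hfm)).indepFun (by simpa using hij))
    (fun i => ⟨(hfm.comp (hev _).measurable).aemeasurable,
      (hfm.comp (hev _).measurable).aemeasurable, by
        have h1 : ∀ i : ℤ, (mu p).map (fun ω => f (ω i)) = (ber p).map f := fun i => by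
          rw [← (hev i).map_eq, Measure.map_map hfm (hev i).measurable]
          rfl
        rw [h1, h1]⟩)
  rw [hE] at h
  filter_upwards [h] with ω hω
  suffices h : Tendsto (fun n : ℕ => x ω n) atTop atTop by
    rw [← Nat.map_cast_int_atTop, tendsto_map'_iff, Nat.map_cast_int_atTop]
    exact h
  rw [← tendsto_intCast_atTop_iff (R := ℝ)]
  have h2 := hω.pos_mul_atTop (by linarith) tendsto_natCast_atTop_atTop
  refine h2.congr fun n => ?_
  have hx : x ω n = ∑ i ∈ Finset.range n, (ω (i + 1) : ℤ) := by
    induction n with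
    | zero => simp [x_zero]
    | succ n ih =>
      rw [Finset.sum_range_succ, ← ih]
      have := x_sub_one ω (n + 1)
      rw [add_sub_cancel_right] at this
      push_cast
      linarith
  rcases Nat.eq_zero_or_pos n with rfl | hn
  · simp [x_zero]
  · rw [div_mul_cancel₀ _ (by positivity)]
    simp [hx, hf]

theorem ae_mem_OmRec (hp : 1 / 2 < (p : ℝ)) : ∀ᵐ ω ∂(mu p), ω ∈ OmRec ∧ R ω ∈ OmRec := by
  have h := ae_tendsto_x hp
  have h' := (measurePreserving_R p).quasiMeasurePreserving.ae h
  filter_upwards [h, h'] with ω h1 h2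
  exact ⟨mem_OmRec_of_tendsto h1 h2, mem_OmRec_of_tendsto h2 (by rwa [R_R])⟩


/-! ### Product measures over `ℕ` and `ℤ` -/

section InfinitePi

variable {X : Type*} [MeasurableSpace X]

theorem eq_infinitePi_nat {P : Measure X} [IsProbabilityMeasure P] {ν : Measure (ℕ → X)}
    (h : ∀ (N : ℕ) (t : ℕ → Set X), (∀ i, MeasurableSet (t i)) →
      ν {α | ∀ i < N, α i ∈ t i} = ∏ i ∈ Finset.range N, P (t i)) :
    ν = Measure.infinitePi fun _ => P := by
  classical
  refine Measure.eq_infinitePi _ fun s t ht => ?_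
  obtain ⟨N, hN⟩ := s.exists_nat_subset_range
  have h1 := h N (fun i => if i ∈ s then t i else univ) fun i => by
    split_ifs
    exacts [ht i, .univ]
  have h2 : {α : ℕ → X | ∀ i < N, α i ∈ if i ∈ s then t i else univ} = Set.pi s t := by
    ext α
    simp only [mem_ofPred_eq, Set.mem_pi, Finset.mem_coe]
    refine ⟨fun hα i hi => ?_, fun hα i _ => ?_⟩
    · simpa [hi] using hα i (Finset.mem_range.1 (hN hi))
    · split_ifs with hi
      exacts [hα i hi, mem_univ _]
  rw [← h2, h1]
  calc ∏ i ∈ Finset.range N, P (if i ∈ s then t i else univ)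
      = ∏ i ∈ Finset.range N, if i ∈ s then P (t i) else 1 :=
        Finset.prod_congr rfl fun i _ => by split_ifs <;> simp
    _ = ∏ i ∈ s, P (t i) := by
        rw [Finset.prod_ite_mem, Finset.inter_eq_right.2 hN]

/-- A stationary measure on `X^ℤ` is determined by its image on `X^ℕ`. -/
theorem eq_infinitePi_int {P : Measure X} [IsProbabilityMeasure P] {ν : Measure (ℤ → X)}
    (h1 : MeasurePreserving (fun (α : ℤ → X) (k : ℤ) => α (k + 1)) ν ν)
    (h2 : ν.map (fun (α : ℤ → X) (i : ℕ) => α i) = Measure.infinitePi fun _ => P) :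
    ν = Measure.infinitePi fun _ => P := by
  have hr : Measurable fun (α : ℤ → X) (i : ℕ) => α i :=
    measurable_pi_iff.2 fun i => measurable_pi_apply _
  refine Measure.eq_infinitePi _ fun s t ht => ?_
  -- Shifting by `M` moves the finite index set `s` into the nonnegative integers.
  obtain ⟨M, hM⟩ : ∃ M : ℕ, ∀ i ∈ s, 0 ≤ i + M := by
    obtain ⟨b, hb⟩ := s.bddBelow
    exact ⟨(-b).toNat, fun i hi => by have := hb hi; omega⟩
  have hit : ∀ (M : ℕ) (α : ℤ → X) k,
      (fun (α : ℤ → X) (k : ℤ) => α (k + 1))^[M] α k = α (k + M) := by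
    intro M
    induction M with
    | zero => simp
    | succ M ih =>
      intro α k
      rw [Function.iterate_succ_apply, ih]
      congr 1
      push_cast
      ring
  have hs : MeasurableSet (Set.pi (s : Set ℤ) t) := .pi s.countable_toSet fun i _ => ht i
  set F : Set (ℕ → X) := {β | ∀ i ∈ s, β (i + M).toNat ∈ t i} with hF
  have hFm : MeasurableSet F := by
    have : F = ⋂ i ∈ s, (fun β : ℕ → X => β (i + M).toNat) ⁻¹' t i := by
      ext β
      simp [hF]
    rw [this]
    exact .biInter s.countable_toSet fun i _ => measurable_pi_apply _ (ht i)
  rw [← (h1.iterate M).measure_preimage hs.nullMeasurableSet]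
  have h3 : (fun (α : ℤ → X) (k : ℤ) => α (k + 1))^[M] ⁻¹' (Set.pi (s : Set ℤ) t) =
      (fun (α : ℤ → X) (i : ℕ) => α i) ⁻¹' F := by
    ext α
    simp only [mem_preimage, Set.mem_pi, hF, mem_ofPred_eq, hit, Finset.mem_coe]
    refine forall₂_congr fun i hi => ?_
    rw [Int.toNat_of_nonneg (hM i hi)]
  rw [h3, ← Measure.map_apply hr hFm, h2]
  have hinj : Function.Injective fun i : s => ((i : ℤ) + M).toNat := fun i j hij => by
    have h4 := hM i i.2
    have h5 := hM j j.2
    apply Subtype.ext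
    simp only at hij
    omega
  have h6 := Measure.map_infinitePi_infinitePi_of_inj (P := fun _ : ℕ => P) hinj
  have h7 : F = (fun (β : ℕ → X) (i : s) => β ((i : ℤ) + M).toNat) ⁻¹'
      (Set.pi (Finset.univ : Finset s) fun i : s => t i) := by
    ext β
    simp [hF]
  rw [h7, ← Measure.map_apply (f := fun (β : ℕ → X) (i : s) => β ((i : ℤ) + M).toNat)
    (measurable_pi_iff.2 fun i => measurable_pi_apply _)
    (.pi (Finset.countable_toSet _) fun i _ => ht i), h6]
  exact (Measure.infinitePi_pi (fun _ : s => P) fun i _ => ht i).trans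
    (Finset.prod_coe_sort s fun i => P (t i))

end InfinitePi

/-! ### The geometric law -/

theorem geom_singleton (r : ℝ) (n : ℕ) : geom r {n} = ENNReal.ofReal ((1 - r) * r ^ n) := by
  unfold geom
  rw [Measure.sum_apply _ (measurableSet_singleton n), tsum_eq_single n]
  · simp
  · intro m hm
    simp [hm]

theorem rho_nonneg (p : unitInterval) : 0 ≤ rho p :=
  mul_nonneg (inv_nonneg.2 p.2.1) (sub_nonneg.2 p.2.2)

theorem mul_rho (hp : 1 / 2 < (p : ℝ)) : p * rho p = 1 - p := by
  unfold rho
  rw [← mul_assoc, mul_inv_cancel₀ (by linarith), one_mul]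

theorem rho_lt_one (hp : 1 / 2 < (p : ℝ)) : rho p < 1 := by
  have := mul_rho hp
  nlinarith

/-- Detailed balance: `tau` preserves the product of the geometric and the Bernoulli law. -/
theorem geom_mul_ber_tau (hp : 1 / 2 < (p : ℝ)) (a : ℕ × ℤˣ) :
    geom (rho p) {(tau a).1} * ber p {(tau a).2} = geom (rho p) {a.1} * ber p {a.2} := by
  have h0 := rho_nonneg p
  have h1 := rho_lt_one hp
  have key : ∀ n, geom (rho p) {n + 1} * ber p {1} = geom (rho p) {n} * ber p {-1} := by
    intro n
    rw [geom_singleton, geom_singleton, ber_one, ber_neg_one,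
      ← ENNReal.ofReal_mul (mul_nonneg (by linarith) (pow_nonneg h0 _)),
      ← ENNReal.ofReal_mul (mul_nonneg (by linarith) (pow_nonneg h0 _)), ← mul_rho hp]
    ring_nf
  obtain ⟨n, e⟩ := a
  rcases Int.units_eq_one_or e with rfl | rfl
  · rcases n with _ | n
    · simp [tau]
    · simp only [tau, if_true, Nat.add_sub_cancel, Nat.add_eq_zero_iff, one_ne_zero, and_false,
        if_false]
      exact (key n).symm
  · simpa [tau] using key n

/-! ### Burke's theorem -/

/-- Sets of paths that depend on the past only. -/
def IsPast (F : Set Om) : Prop := ∀ ω ω' : Om, (∀ i ≤ 0, ω i = ω' i) → ω ∈ F → ω' ∈ F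

/-- By the involution, prescribing `(q 1, T ω 1)` is prescribing `(q 0, ω 1)`, and `ω 1` is
independent of the past. -/
theorem mu_one_step (hp : 1 / 2 < (p : ℝ)) {F : Set Om} (hF : MeasurableSet F)
    (hF' : IsPast F) (a : ℕ) (e : ℤˣ) :
    mu p {ω | q ω 1 = a ∧ T ω 1 = e ∧ ω ∈ F} =
      mu p {ω | q ω 0 = (tau (a, e)).1 ∧ ω ∈ F} * ber p {(tau (a, e)).2} := by
  rw [← mu_inter_eval_one p (F := {ω | q ω 0 = (tau (a, e)).1 ∧ ω ∈ F})]
  · refine measure_congr ?_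
    filter_upwards [ae_mem_OmRec hp] with ω hω
    have h := step hω.1.1 1
    have h1 : (q ω 1 = a ∧ T ω 1 = e) ↔ q ω 0 = (tau (a, e)).1 ∧ ω 1 = (tau (a, e)).2 := by
      rw [← Prod.mk.injEq, h, tau_eq_iff]
      simp [Prod.ext_iff]
    apply propext
    change (q ω 1 = a ∧ T ω 1 = e ∧ ω ∈ F) ↔
      (q ω 0 = (tau (a, e)).1 ∧ ω ∈ F) ∧ ω 1 = (tau (a, e)).2
    tauto
  · exact (measurable_q 0 (measurableSet_singleton _)).inter hF
  · rintro ω ω' h ⟨h1, h2⟩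
    exact ⟨(q_congr h).symm.trans h1, hF' ω ω' h h2⟩

/-- A measure on a countable type is determined by the masses of the points. -/
theorem measure_map_restrict_eq {Ω X : Type*} [MeasurableSpace Ω] [MeasurableSpace X]
    [Countable X] [MeasurableSingletonClass X] {m : Measure Ω} {f : Ω → X} (hf : Measurable f)
    {E : Set Ω} {c : ENNReal} {ν : Measure X}
    (h : ∀ x, m {ω | f ω = x ∧ ω ∈ E} = c * ν {x}) (S : Set X) :
    m {ω | f ω ∈ S ∧ ω ∈ E} = c * ν S := by
  have h1 : (m.restrict E).map f = c • ν := by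
    refine Measure.ext_of_singleton fun x => ?_
    rw [Measure.map_apply hf (measurableSet_singleton x),
      Measure.restrict_apply (hf (measurableSet_singleton x))]
    exact h x
  have h2 := congrArg (fun ν => ν S) h1
  rw [Measure.map_apply hf .of_discrete, Measure.restrict_apply (hf .of_discrete)] at h2
  exact h2

theorem mu_q_shift (hp : 1 / 2 < (p : ℝ)) {F : Set Om} (hF : MeasurableSet F) (a : ℕ) :
    mu p {ω | q ω 0 = a ∧ ω ∈ F} = mu p {ω | q ω 1 = a ∧ sh 1 ω ∈ F} := by
  have hm : MeasurableSet {ω | q ω 0 = a ∧ ω ∈ F} :=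
    (measurable_q 0 (measurableSet_singleton a)).inter hF
  rw [← (measurePreserving_sh p 1).measure_preimage hm.nullMeasurableSet]
  refine measure_congr ?_
  filter_upwards [ae_mem_OmRec hp] with ω hω
  apply propext
  change (q (sh 1 ω) 0 = a ∧ sh 1 ω ∈ F) ↔ _
  rw [q_sh hω.1.1, zero_add]
  rfl

/-- The stationary law of the queue length. -/
theorem mu_q_eq (hp : 1 / 2 < (p : ℝ)) (a : ℕ) : mu p {ω | q ω 0 = a} = geom (rho p) {a} := by
  set π : ℕ → ENNReal := fun a => mu p {ω | q ω 0 = a} with hπ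
  have hrec : ∀ a, π a = π (tau (a, 1)).1 * ber p {(tau (a, 1)).2} +
      π (tau (a, -1)).1 * ber p {(tau (a, -1)).2} := by
    intro a
    have h0 := mu_q_shift hp .univ a
    have h1 := mu_one_step hp .univ (fun _ _ _ _ => trivial) a 1
    have h2 := mu_one_step hp .univ (fun _ _ _ _ => trivial) a (-1)
    simp only [mem_univ, and_true] at h0 h1 h2
    simp only [hπ]
    rw [h0, ← h1, ← h2, ← measure_union]
    · congr 1
      ext ω
      rcases Int.units_eq_one_or (T ω 1) with e | e <;> simp [e]
    · rw [Set.disjoint_left]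
      rintro ω ⟨_, h1⟩ ⟨_, h2⟩
      rw [h1] at h2
      exact absurd h2 (by decide)
    · exact (measurable_q 1 (measurableSet_singleton a)).inter
        (((measurable_pi_apply 1).comp measurable_T) (measurableSet_singleton (-1)))
  have hfin : ∀ a, π a ≠ ⊤ := fun a => measure_ne_top _ _
  have hp0 := p.2.1
  have hp1 := p.2.2
  have h0 := rho_nonneg p
  have h1 := rho_lt_one hp
  have hmul : ∀ (a : ℕ) (r : ℝ), 0 ≤ r → (π a * ENNReal.ofReal r).toReal = (π a).toReal * r :=
    fun a r hr => by rw [ENNReal.toReal_mul, ENNReal.toReal_ofReal hr]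
  have hzero : (π 0).toReal = (π 0).toReal * p + (π 1).toReal * p := by
    have h := congrArg ENNReal.toReal (hrec 0)
    simp only [tau, if_true, reduceIte, show (-1 : ℤˣ) ≠ 1 by decide, ber_one] at h
    rw [ENNReal.toReal_add (ENNReal.mul_ne_top (hfin _) ENNReal.ofReal_ne_top)
      (ENNReal.mul_ne_top (hfin _) ENNReal.ofReal_ne_top), hmul _ _ hp0, hmul _ _ hp0] at h
    exact h
  have hsucc : ∀ n, (π (n + 1)).toReal = (π n).toReal * (1 - p) + (π (n + 2)).toReal * p := by
    intro n
    have h := congrArg ENNReal.toReal (hrec (n + 1))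
    simp only [tau, if_true, reduceIte, show (-1 : ℤˣ) ≠ 1 by decide, Nat.add_sub_cancel,
      Nat.add_eq_zero_iff, one_ne_zero, and_false, ber_one, ber_neg_one] at h
    rw [ENNReal.toReal_add (ENNReal.mul_ne_top (hfin _) ENNReal.ofReal_ne_top)
      (ENNReal.mul_ne_top (hfin _) ENNReal.ofReal_ne_top), hmul _ _ (by linarith),
      hmul _ _ hp0] at h
    exact h
  have hρ := mul_rho hp
  -- The boundary equation at 0 gives `p π 1 = (1 - p) π 0`, which the second-order recursion
  -- propagates; so only the geometric solution survives.
  have hstep : ∀ n, (π (n + 1)).toReal = rho p * (π n).toReal := by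
    intro n
    induction n with
    | zero =>
      have : (p : ℝ) * (π 1).toReal = p * (rho p * (π 0).toReal) := by
        rw [← mul_assoc, hρ]
        linarith
      exact mul_left_cancel₀ (by linarith) this
    | succ n ih =>
      have h := hsucc n
      have : (p : ℝ) * (π (n + 2)).toReal = p * (rho p * (π (n + 1)).toReal) := by
        rw [← mul_assoc, hρ]
        have h3 : (π n).toReal * (1 - p) = p * (π (n + 1)).toReal := by
          rw [ih, ← hρ]
          ring
        linarith
      exact mul_left_cancel₀ (by linarith) this
  have hpow : ∀ n, (π n).toReal = (π 0).toReal * rho p ^ n := by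
    intro n
    induction n with
    | zero => simp
    | succ n ih =>
      rw [hstep, ih]
      ring
  have := isProbabilityMeasure_geom h0 h1
  have hc : ∀ n, π n = ENNReal.ofReal ((π 0).toReal / (1 - rho p)) * geom (rho p) {n} := by
    intro n
    rw [← ENNReal.ofReal_toReal (hfin n), hpow, geom_singleton,
      ← ENNReal.ofReal_mul (div_nonneg ENNReal.toReal_nonneg (by linarith))]
    congr 1
    have : 1 - rho p ≠ 0 := by linarith
    field_simp
  -- Comparing total masses shows that the proportionality constant is 1.
  have htot := measure_map_restrict_eq (E := univ) (ν := geom (rho p)) (measurable_q 0)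
    (fun n => by simpa using hc n) univ
  simp only [mem_univ, and_self, measure_univ, mul_one] at htot
  rw [ofPred_true, measure_univ] at htot
  have := hc a
  rw [← htot, one_mul] at this
  exact this

theorem measurableSet_forall_lt {X Y : Type*} [MeasurableSpace X] [MeasurableSpace Y]
    {f : ℕ → X → Y} (hf : ∀ i, Measurable (f i)) {t : ℕ → Set Y}
    (ht : ∀ i, MeasurableSet (t i)) (N : ℕ) : MeasurableSet {a | ∀ i < N, f i a ∈ t i} := by
  simp only [ofPred_forall]
  exact .iInter fun i => .iInter fun _ => hf i (ht i)

theorem measurable_T_apply (i : ℤ) : Measurable fun ω => T ω i :=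
  (measurable_pi_apply i).comp measurable_T

theorem isPast_T (t : ℕ → Set ℤˣ) (N : ℕ) : IsPast {ω | ∀ i < N, T ω (-i) ∈ t i} := by
  intro ω ω' h h1 i hi
  rw [← T_congr h _ (by omega)]
  exact h1 i hi

/-- The induction step of Burke's theorem: by detailed balance, independence of `F` and the
geometric queue length survives one time step, with the new output independent of both. -/
theorem mu_one_step_of_indep (hp : 1 / 2 < (p : ℝ)) {F : Set Om} (hF : MeasurableSet F)
    (hF' : IsPast F) {c : ENNReal}
    (hc : ∀ b, mu p {ω | q ω 0 = b ∧ ω ∈ F} = geom (rho p) {b} * c) (a : ℕ) (D : Set ℤˣ) :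
    mu p {ω | q ω 1 = a ∧ T ω 1 ∈ D ∧ ω ∈ F} = geom (rho p) {a} * c * ber p D := by
  have h := measure_map_restrict_eq (m := mu p) (ν := ber p) (E := {ω | q ω 1 = a ∧ ω ∈ F})
    (c := geom (rho p) {a} * c) (measurable_T_apply 1) (fun e => ?_) D
  · rw [← h]
    congr 1
    ext ω
    simp only [mem_ofPred_eq]
    tauto
  · have h1 := mu_one_step hp hF hF' a e
    rw [hc, mul_right_comm, geom_mul_ber_tau hp (a, e), mul_right_comm] at h1
    rw [← h1]
    congr 1
    ext ω
    simp only [mem_ofPred_eq]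
    tauto

theorem burke_cylinder (hp : 1 / 2 < (p : ℝ)) (N : ℕ) :
    ∀ (t : ℕ → Set ℤˣ) (a : ℕ), mu p {ω | q ω 0 = a ∧ ∀ i < N, T ω (-i) ∈ t i} =
      geom (rho p) {a} * ∏ i ∈ Finset.range N, ber p (t i) := by
  induction N with
  | zero =>
    intro t a
    simpa using mu_q_eq hp a
  | succ N ih =>
    intro t a
    have hm : ∀ N (t : ℕ → Set ℤˣ), MeasurableSet {ω | ∀ i < N, T ω (-(i : ℕ)) ∈ t i} :=
      fun N t => measurableSet_forall_lt (fun i => measurable_T_apply _) (fun i => .of_discrete) N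
    have h1 := mu_q_shift hp (hm (N + 1) t) a
    -- After the time shift the latest output sits at time 1 and is split off; the others form a
    -- past event with `t` reindexed by one.
    have h2 : {ω | q ω 1 = a ∧ sh 1 ω ∈ {ω | ∀ i < N + 1, T ω (-(i : ℕ)) ∈ t i}} =
        {ω | q ω 1 = a ∧ T ω 1 ∈ t 0 ∧ ω ∈ {ω | ∀ i < N, T ω (-(i : ℕ)) ∈ t (i + 1)}} := by
      ext ω
      simp only [mem_ofPred_eq, T_sh, sh]
      refine and_congr_right fun _ => ⟨fun h => ⟨by simpa using h 0 (by omega), fun i hi => ?_⟩,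
        fun h i hi => ?_⟩
      · have := h (i + 1) (by omega)
        push_cast at this
        rwa [show -((i : ℤ) + 1) + 1 = -i by ring] at this
      · rcases i with _ | i
        · simpa using h.1
        · push_cast
          rw [show -((i : ℤ) + 1) + 1 = -i by ring]
          exact h.2 i (by omega)
    rw [h2] at h1
    refine h1.trans ?_
    rw [mu_one_step_of_indep hp (hm N _) (isPast_T _ N) (fun b => ih (fun i => t (i + 1)) b),
      Finset.prod_range_succ', mul_assoc]

/-- **Burke's theorem**: the queue length is independent of the past output. -/
theorem burke_past (hp : 1 / 2 < (p : ℝ)) (a : ℕ) {F : Set (ℕ → ℤˣ)} (hF : MeasurableSet F) :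
    mu p {ω | q ω 0 = a ∧ (fun i : ℕ => T ω (-i)) ∈ F} =
      geom (rho p) {a} * Measure.infinitePi (fun _ : ℕ => ber p) F := by
  have hf : Measurable fun (ω : Om) (i : ℕ) => T ω (-i) :=
    measurable_pi_iff.2 fun i => measurable_T_apply _
  have hq : MeasurableSet {ω | q ω 0 = a} := measurable_q 0 (measurableSet_singleton a)
  -- This happens for `p = 1` and `a > 0`, where conditioning on the queue length is impossible.
  by_cases h0 : geom (rho p) {a} = 0
  · rw [h0, zero_mul]
    refine measure_mono_null (fun ω hω => hω.1) ((mu_q_eq hp a).trans h0)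
  have htop : geom (rho p) {a} ≠ ⊤ := by
    rw [geom_singleton]
    exact ENNReal.ofReal_ne_top
  have happ : ∀ F : Set (ℕ → ℤˣ), MeasurableSet F →
      (((mu p).restrict {ω | q ω 0 = a}).map fun (ω : Om) (i : ℕ) => T ω (-i)) F =
        mu p {ω | q ω 0 = a ∧ (fun i : ℕ => T ω (-i)) ∈ F} := by
    intro F hF
    rw [Measure.map_apply hf hF, Measure.restrict_apply (hf hF), inter_comm]
    rfl
  have h1 : (geom (rho p) {a})⁻¹ •
      (((mu p).restrict {ω | q ω 0 = a}).map fun (ω : Om) (i : ℕ) => T ω (-i)) =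
      Measure.infinitePi fun _ : ℕ => ber p := by
    refine eq_infinitePi_nat fun N t ht => ?_
    rw [Measure.smul_apply, happ _ (measurableSet_forall_lt (fun i => measurable_pi_apply i) ht N)]
    simp only [mem_ofPred_eq]
    rw [burke_cylinder hp, smul_eq_mul, ← mul_assoc, ENNReal.inv_mul_cancel h0 htop, one_mul]
  rw [← h1, Measure.smul_apply, happ _ hF, smul_eq_mul, ← mul_assoc,
    ENNReal.mul_inv_cancel h0 htop, one_mul]

theorem burke (hp : 1 / 2 < (p : ℝ)) {F : Set Om} (hF : MeasurableSet F) (hF' : IsPast F)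
    (S : Set ℕ) : mu p {ω | q ω 0 ∈ S ∧ T ω ∈ F} = geom (rho p) S * mu p F := by
  -- At positive times `g β` takes the value `β 0`, which is immaterial since `F` depends on the
  -- past only.
  set g : (ℕ → ℤˣ) → Om := fun β i => β (-i).toNat with hg
  have hgm : Measurable g := measurable_pi_iff.2 fun i => measurable_pi_apply _
  have hgF : ∀ ω : Om, g (fun i : ℕ => ω (-i)) ∈ F ↔ ω ∈ F := by
    have h : ∀ (ω : Om), ∀ i ≤ 0, g (fun i : ℕ => ω (-i)) i = ω i := fun ω i hi => by
      simp only [hg]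
      congr 1
      omega
    exact fun ω => ⟨hF' _ _ (h ω), hF' _ _ fun i hi => (h ω i hi).symm⟩
  have hmu : Measure.infinitePi (fun _ : ℕ => ber p) (g ⁻¹' F) = mu p F := by
    have hinj : Function.Injective fun i : ℕ => (-i : ℤ) := fun i j h => by simpa using h
    rw [← Measure.map_infinitePi_infinitePi_of_inj (P := fun _ : ℤ => ber p) hinj,
      Measure.map_apply (measurable_pi_iff.2 fun i => measurable_pi_apply _) (hgm hF)]
    change mu p _ = _
    congr 1
    ext ω
    exact hgF ω
  rw [mul_comm]
  refine measure_map_restrict_eq (E := {ω | T ω ∈ F}) (measurable_q 0) (fun a => ?_) S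
  rw [mul_comm, ← hmu, ← burke_past hp a (hgm hF)]
  congr 1
  ext ω
  exact and_congr_right fun _ => (hgF (T ω)).symm

theorem measurePreserving_T (hp : 1 / 2 < (p : ℝ)) : MeasurePreserving T (mu p) (mu p) := by
  refine ⟨measurable_T, ?_⟩
  have hRT : Measurable (R ∘ T) := measurable_R.comp measurable_T
  have hr : Measurable fun (α : Om) (i : ℕ) => α i :=
    measurable_pi_iff.2 fun i => measurable_pi_apply _
  -- Reversal turns the past output into the coordinates with nonnegative index, whose law Burke's
  -- theorem gives after summing over the queue length.
  have key : (mu p).map (R ∘ T) = mu p := by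
    refine eq_infinitePi_int ⟨measurable_sh 1, ?_⟩ ?_
    · change Measure.map (sh 1) _ = _
      rw [Measure.map_map (measurable_sh 1) hRT]
      have h : sh 1 ∘ (R ∘ T) = (R ∘ T) ∘ sh (-1) := by
        funext ω
        simp [T_sh, R_sh]
      rw [h, ← Measure.map_map hRT (measurable_sh _), (measurePreserving_sh p (-1)).map_eq]
    · refine Measure.ext fun F hF => ?_
      rw [Measure.map_map hr hRT, Measure.map_apply (hr.comp hRT) hF]
      have := isProbabilityMeasure_geom (rho_nonneg p) (rho_lt_one hp)
      have h := measure_map_restrict_eq (m := mu p) (ν := geom (rho p))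
        (E := {ω | (fun i : ℕ => T ω (-i)) ∈ F}) (measurable_q 0)
        (fun a => (burke_past hp a hF).trans (mul_comm _ _)) univ
      rw [measure_univ, mul_one] at h
      rw [← h]
      congr 1
      ext ω
      simp [R, mem_preimage, Function.comp_def]
  have h : T = R ∘ (R ∘ T) := by
    funext ω
    simp [R_R]
  rw [h, ← Measure.map_map measurable_R hRT, key, (measurePreserving_R p).map_eq]

theorem measurePreserving_Tpow (hp : 1 / 2 < (p : ℝ)) (k : ℤ) :
    MeasurePreserving (Tpow k) (mu p) (mu p) := by
  have hT := measurePreserving_T hp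
  have hR := measurePreserving_R p
  rcases k with k | k
  · exact hT.iterate k
  · exact (show MeasurePreserving Tinv (mu p) (mu p) from
      hR.comp (hT.comp hR)).iterate (k + 1)

theorem ae_mem_OmStar (hp : 1 / 2 < (p : ℝ)) : ∀ᵐ ω ∂(mu p), ω ∈ OmStar :=
  ae_all_iff.2 fun k =>
    (measurePreserving_Tpow hp k).quasiMeasurePreserving.ae (ae_mem_OmRec hp)

/-! ### The law of `φ` -/

theorem measurable_q_iterate (i : ℕ) : Measurable fun ω => q (T^[i] ω) 0 :=
  (measurable_q 0).comp (measurable_T.iterate i)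

/-- The queue lengths of `T ω, T² ω, …` at time 0 depend only on the past of `T ω`, so `burke`
splits off the first factor. -/
theorem phi_cylinder (hp : 1 / 2 < (p : ℝ)) (N : ℕ) : ∀ t : ℕ → Set ℕ,
    mu p {ω | ∀ i < N, q (T^[i] ω) 0 ∈ t i} = ∏ i ∈ Finset.range N, geom (rho p) (t i) := by
  induction N with
  | zero => simp
  | succ N ih =>
    intro t
    rw [Finset.prod_range_succ', ← ih fun i => t (i + 1), mul_comm, ← burke hp
      (measurableSet_forall_lt measurable_q_iterate (fun i => .of_discrete) N)]
    · congr 1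
      ext ω
      simp only [mem_ofPred_eq, ← Function.iterate_succ_apply]
      refine ⟨fun h => ⟨h 0 (by omega), fun i hi => h (i + 1) (by omega)⟩, fun h i hi => ?_⟩
      rcases i with _ | i
      · exact h.1
      · exact h.2 i (by omega)
    · intro ω ω' h h1 i hi
      rw [← q_congr (T_iterate_congr h i)]
      exact h1 i hi

theorem measurable_shift : Measurable shift :=
  measurable_pi_iff.2 fun k => measurable_pi_apply (k + 1)

theorem measurePreserving_phi (hp : 1 / 2 < (p : ℝ)) :
    MeasurePreserving phi (mu p) (gam p) := by
  have := isProbabilityMeasure_geom (rho_nonneg p) (rho_lt_one hp)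
  refine ⟨measurable_phi, eq_infinitePi_int ⟨measurable_shift, ?_⟩ ?_⟩
  · change Measure.map shift _ = _
    rw [Measure.map_map measurable_shift measurable_phi]
    have h : shift ∘ phi =ᵐ[mu p] phi ∘ T := by
      filter_upwards [ae_mem_OmStar hp] with ω hω
      exact (phi_T hω).symm
    rw [Measure.map_congr h, ← Measure.map_map measurable_phi measurable_T,
      (measurePreserving_T hp).map_eq]
  · have hr : Measurable fun (α : ℤ → ℕ) (i : ℕ) => α i :=
      measurable_pi_iff.2 fun i => measurable_pi_apply _
    refine eq_infinitePi_nat fun N t ht => ?_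
    rw [Measure.map_map hr measurable_phi, Measure.map_apply (hr.comp measurable_phi)
      (measurableSet_forall_lt (fun i => measurable_pi_apply i) ht N), ← phi_cylinder hp N t]
    congr 1
    ext ω
    simp only [mem_preimage, mem_ofPred_eq, Function.comp_apply, phi_eq_q]
    rfl


/-! ### Empty queues -/

theorem gam_forall_ne_zero (hp : 1 / 2 < (p : ℝ)) {I : Set ℤ} (hI : I.Infinite) :
    gam p {α | ∀ k ∈ I, α k ≠ 0} = 0 := by
  have := isProbabilityMeasure_geom (rho_nonneg p) (rho_lt_one hp)
  have hr : geom (rho p) {0}ᶜ < 1 := by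
    rw [prob_compl_eq_one_sub (measurableSet_singleton 0), geom_singleton]
    refine ENNReal.sub_lt_self ENNReal.one_ne_top one_ne_zero (ne_of_gt ?_)
    have := rho_lt_one hp
    rw [ENNReal.ofReal_pos]
    simpa using this
  refine le_antisymm (ge_of_tendsto' (ENNReal.tendsto_pow_atTop_nhds_zero_of_lt_one hr)
    fun n => ?_) zero_le
  obtain ⟨s, hs, rfl⟩ := hI.exists_subset_card_eq n
  have h : gam p (Set.pi s fun _ => {0}ᶜ) = geom (rho p) {0}ᶜ ^ s.card := by
    rw [gam, Measure.infinitePi_pi _ fun i _ => .of_discrete, Finset.prod_const]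
  rw [← h]
  exact measure_mono fun α hα k hk => hα k (hs hk)

theorem ae_exists_zero (hp : 1 / 2 < (p : ℝ)) :
    ∀ᵐ α ∂(gam p), ∀ K : ℤ, (∃ k, K ≤ k ∧ α k = 0) ∧ ∃ k, k ≤ K ∧ α k = 0 := by
  refine ae_all_iff.2 fun K => Eventually.and ?_ ?_
  · refine measure_mono_null (fun α hα k hk h0 => hα ⟨k, hk, h0⟩)
      (gam_forall_ne_zero hp (Ici_infinite K))
  · refine measure_mono_null (fun α hα k hk h0 => hα ⟨k, hk, h0⟩)
      (gam_forall_ne_zero hp (Iic_infinite K))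

/-- Column `n` of `ω` is `phi (sh n ω)`, so it has law γ like column 0. -/
theorem ae_mem_OmEmpty (hp : 1 / 2 < (p : ℝ)) : ∀ᵐ ω ∂(mu p), ω ∈ OmEmpty := by
  have h : ∀ᵐ ω ∂(mu p), ∀ n K : ℤ, (∃ k, K ≤ k ∧ phi (sh n ω) k = 0) ∧
      ∃ k, k ≤ K ∧ phi (sh n ω) k = 0 :=
    ae_all_iff.2 fun n => ((measurePreserving_phi hp).comp
      (measurePreserving_sh p n)).quasiMeasurePreserving.ae (ae_exists_zero hp)
  filter_upwards [ae_mem_OmStar hp, h] with ω hω h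
  refine ⟨hω, fun n K => ?_⟩
  have hφ : ∀ k, phi (sh n ω) k = q (Tpow k ω) n := fun k => by
    rw [phi_eq_q, Tpow_sh, q_sh (hω k).1.1, zero_add]
  simpa only [hφ] using h n K

/-! ### The isomorphism -/

/-- Lusin–Souslin: an injective Borel map on a standard Borel space is a measurable embedding, so
its inverse extends measurably to the whole target. -/
theorem exists_measurable_inverse :
    ∃ psi : (ℤ → ℕ) → Om, Measurable psi ∧ ∀ ω ∈ OmEmpty, psi (phi ω) = ω := by
  have := measurableSet_OmEmpty.standardBorel
  have hemb : MeasurableEmbedding fun ω : OmEmpty => phi ω :=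
    (measurable_phi.comp measurable_subtype_coe).measurableEmbedding
      fun ω ω' h => Subtype.ext (injOn_phi ω.2 ω'.2 h)
  obtain ⟨psi, h1, h2⟩ := hemb.exists_measurable_extend measurable_subtype_coe fun _ => ⟨1⟩
  exact ⟨psi, h1, fun ω hω => congrFun h2 ⟨ω, hω⟩⟩

theorem measurePreserving_shift (hp : 1 / 2 < (p : ℝ)) :
    MeasurePreserving shift (gam p) (gam p) :=
  have := isProbabilityMeasure_geom (rho_nonneg p) (rho_lt_one hp)
  ⟨measurable_shift, Measure.map_infinitePi_infinitePi_of_inj (P := fun _ : ℤ => geom (rho p))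
    (add_left_injective 1)⟩

end BurkeShift

end

theorem theorem2 (p : unitInterval) (hp : 1 / 2 < (p : ℝ)) :
    -- all powers of `T` are defined on `Ω*`, a set of full measure
    ((∀ᵐ ω ∂(mu p), ω ∈ OmStar) ∧ Set.BijOn T OmStar OmStar ∧
      (∀ ω ∈ OmStar, ∀ k : ℤ, Tpow k ω ∈ OmStar ∧ T (Tpow k ω) = Tpow (k + 1) ω)) ∧
    -- (i)
    MeasurePreserving phi (mu p) (gam p) ∧
    -- (ii) and (iii)
    (∃ A : Set Om, A ⊆ OmStar ∧ MeasurableSet A ∧ (∀ᵐ ω ∂(mu p), ω ∈ A) ∧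
      Set.BijOn T A A ∧ Set.InjOn phi A ∧
      ∃ psi : (ℤ → ℕ) → Om, MeasurePreserving psi (gam p) (mu p) ∧
        (∀ ω ∈ A, psi (phi ω) = ω) ∧
        (∀ᵐ α ∂(gam p), psi α ∈ A ∧ phi (psi α) = α) ∧
        (∀ ω ∈ A, T ω = psi (shift (phi ω)))) ∧
    -- in particular, `T` is isomorphic to a two-sided Bernoulli shift
    MetricallyIsomorphic T (mu p) shift (gam p) := by
  obtain ⟨psi, hpsi, hinv⟩ := exists_measurable_inverse
  have hφ := measurePreserving_phi hp
  have hA := ae_mem_OmEmpty hp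
  have hsub : OmEmpty ⊆ OmStar := fun ω h => h.1
  have hpsi' : MeasurePreserving psi (gam p) (mu p) := by
    refine ⟨hpsi, ?_⟩
    have h : psi ∘ phi =ᵐ[mu p] id := by
      filter_upwards [hA] with ω hω
      exact hinv ω hω
    rw [← hφ.map_eq, Measure.map_map hpsi measurable_phi, Measure.map_congr h, Measure.map_id]
  have hright : ∀ᵐ α ∂(gam p), psi α ∈ OmEmpty ∧ phi (psi α) = α := by
    have hm : MeasurableSet {α | psi α ∈ OmEmpty ∧ phi (psi α) = α} :=
      (hpsi measurableSet_OmEmpty).inter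
        (measurableSet_eq_fun (measurable_phi.comp hpsi) measurable_id)
    rw [← hφ.map_eq, ae_map_iff measurable_phi.aemeasurable hm]
    filter_upwards [hA] with ω hω
    rw [hinv ω hω]
    exact ⟨hω, rfl⟩
  refine ⟨⟨ae_mem_OmStar hp, ?_, fun ω h k => ⟨Tpow_mem_OmStar h k, T_Tpow h k⟩⟩, hφ, ?_, ?_⟩
  · exact bijOn_T subset_rfl (fun _ => T_mem_OmStar) (fun _ => Tinv_mem_OmStar)
  · refine ⟨OmEmpty, hsub, measurableSet_OmEmpty, hA,
      bijOn_T hsub mapsTo_T_OmEmpty mapsTo_Tinv_OmEmpty, injOn_phi, psi, hpsi', hinv, hright,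
      fun ω hω => ?_⟩
    -- `shift (phi ω)` is `phi (T ω)`, and `psi` inverts `phi` there because `OmEmpty` is invariant
    -- under `T`.
    rw [← phi_T hω.1, hinv _ (mapsTo_T_OmEmpty hω)]
  · refine ⟨measurePreserving_T hp, measurePreserving_shift hp, phi, psi, hφ, hpsi', ?_, ?_, ?_⟩
    · filter_upwards [hA] with ω hω using hinv ω hω
    · filter_upwards [hright] with α hα using hα.2
    · filter_upwards [ae_mem_OmStar hp] with ω hω using phi_T hω
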